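/- For $z\in\mathbb{C}$ put $[z]=\lfloor \operatorname{Re} z+\tfrac12\rfloor+i\lfloor \operatorname{Im} z+\tfrac12\rfloor\in\mathbb{Z}[i]$, and let $\mathfrak{F}=\{z\in\mathbb{C}:-\tfrac12\le \operatorname{Re} z,\operatorname{Im} z<\tfrac12\}$. For $z\in\mathfrak{F}\setminus\{0\}$ the Hurwitz continued fraction of $z$ is the sequence of elements $a_n=[z_n^{-1}]$, $n\ge 1$, where $z_1=z$ and $z_{n+1}=z_n^{-1}-[z_n^{-1}]$; it stops as soon as some $z_{n+1}=0$, and we write $z=[0;a_1,a_2,a_3,\ldots]$ when it is infinite. For real $L>0$ let $$E_L=\{z=[0;a_1,a_2,a_3,\ldots]\in\mathfrak{F}:\ |a_n|\ge L\ \text{ for all } n\ge 1\}$$ (points with an infinite expansion). Let $\mathrm{Bad}_{\mathbb{C}}$ be the set of badly approximable complex numbers, that is, of all $\zeta\in\mathbb{C}\setminus\mathbb{Q}(i)$ for which there is $c>0$ such that $|\zeta-p/q|\ge c/|q|^2$ for all $p\in\mathbb{Z}[i]$ and all $q\in\mathbb{Z}[i]\setminus\{0\}$. Then, with $\dim_H$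 denoting Hausdorff dimension, $$\lim_{L\to\infty}\dim_H\bigl(E_L\cap \mathrm{Bad}_{\mathbb{C}}\bigr)=1 .$$ -/

import Mathlib

namespace HurwitzCF

/-- The nearest Gaussian integer `[z] = ⌊Re z + 1/2⌋ + i ⌊Im z + 1/2⌋`. -/
noncomputable def nearest (z : ℂ) : GaussianInt :=
  ⟨⌊z.re + 1 / 2⌋, ⌊z.im + 1 / 2⌋⟩

/-- The square `𝔉 = {z : -1/2 ≤ Re z, Im z < 1/2}`. -/
def fundSquare : Set ℂ :=
  {z | -(1 / 2) ≤ z.re ∧ z.re < 1 / 2 ∧ -(1 / 2) ≤ z.im ∧ z.im < 1 / 2}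

/-- The Hurwitz map `T z = 1/z - [1/z]`. It is meant for nonzero points of `𝔉`; at `0`, where the
algorithm stops, the formula returns `0`. -/
noncomputable def hurwitzMap (z : ℂ) : ℂ :=
  z⁻¹ - (nearest z⁻¹ : ℂ)

/-- With indices starting at `0`: `remainder z n` is `z_{n+1}`, where `z_1 = z`,
`z_{n+1} = T z_n`. -/
noncomputable def remainder (z : ℂ) (n : ℕ) : ℂ :=
  hurwitzMap^[n] z

/-- With indices starting at `0`: `element z n` is the Hurwitz element `a_{n+1} = [1 / z_{n+1}]`
of a point `z` of `𝔉`. It is meaningful as long as `z_{n+1} ≠ 0`. -/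
noncomputable def element (z : ℂ) (n : ℕ) : GaussianInt :=
  nearest (remainder z n)⁻¹

/-- The algorithm started at `z` never reaches `0`, so the Hurwitz continued fraction
`[0; a_1, a_2, …]` is an infinite one. -/
def HasInfiniteExpansion (z : ℂ) : Prop :=
  ∀ n : ℕ, remainder z n ≠ 0

/-- The set `E_L` of the `z = [0; a_1, a_2, …]` in `𝔉` with `L ≤ |a_n|` for all `n ≥ 1`. -/
def largeElements (L : ℝ) : Set ℂ :=
  {z | z ∈ fundSquare ∧ HasInfiniteExpansion z ∧ ∀ n : ℕ, L ≤ ‖(element z n : ℂ)‖}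

/-- The field `ℚ(i)` as a subset of `ℂ`. -/
def gaussianRationals : Set ℂ :=
  {z | ∃ r s : ℚ, z = (r : ℂ) + (s : ℂ) * Complex.I}

/-- The set of badly approximable complex numbers. -/
def badlyApproximable : Set ℂ :=
  {z | z ∉ gaussianRationals ∧ ∃ c : ℝ, 0 < c ∧ ∀ p q : GaussianInt, q ≠ 0 →
    c / ‖(q : ℂ)‖ ^ 2 ≤ ‖z - (p : ℂ) / (q : ℂ)‖}

end HurwitzCF

/-!
The limit is pinned down by an upper bound for the dimension of `E_L` alone and a lower bound for
subsets of `E_L` given by finitely many elements.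

For `1 < s`, the points of `E_L` with prescribed first elements `a_1, …, a_n` form a set of diameter
at most `2 ∏ 4 / |a_i|²`, because `w ↦ (a + w)⁻¹` contracts the unit disc by a factor `4 / |a|²` if
`|a| ≥ 2`. The series `∑ (4 / |a|²) ^ s` over the Gaussian integers converges, so its part with
`|a| ≥ L` is at most `1` when `L` is large; covering by words of length `n` (`dimH_le_of_code`) then gives
`dim E_L ≤ s`.

For `s < 1`, take the `M²` elements `m + n i` with `M ≤ m, n < 2 M`, where `M` is large. Every
sequence of these is the Hurwitz expansion of its value (`cfValue_mem_largeElements`), since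
the tails stay well inside the fundamental square. Values of sequences that first differ at the
index `n` are at distance at least a constant times `(25 M²) ^ (-n)` (`le_dist_cfValue`), so sending
such a value to the real number whose digits in base `M²` are the elements is an `s`-Hölder
map onto `[0, 1]` as soon as `(25 M²) ^ s ≤ M²`, and the set of values has dimension at least `s`
(`le_dimH_range_of_separated`). As the elements are bounded, the values are badly approximable,
which is proved by a descent along the Hurwitz algorithm (`half_le_norm_mul_norm_sub`).
-/

open Filter MeasureTheory Set
open scoped Topology ENNReal NNReal

/-! ### Dimension bounds from symbolic codings -/

lemma ENNReal.tsum_prod_fin_eq_pow {ι : Type*} (f : ι → ℝ≥0∞) (n : ℕ) :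
    ∑' w : Fin n → ι, ∏ i, f (w i) = (∑' a, f a) ^ n := by
  induction n with
  | zero => simp
  | succ n ih =>
    rw [← (Fin.consEquiv fun _ : Fin (n + 1) => ι).tsum_eq, ENNReal.tsum_prod', pow_succ', ← ih,
      ← ENNReal.tsum_mul_right]
    refine tsum_congr fun a => ?_
    rw [← ENNReal.tsum_mul_left]
    refine tsum_congr fun w => ?_
    simp [Fin.prod_univ_succ, Fin.consEquiv]

/-- If points of `E` whose codes agree on the first `n` letters are within
`D * ∏_{i < n} r (code x i)` of each other, the words of length `n` index a cover of `E` for which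
the sum of the `s`-th powers of the diameters is at most `D ^ s * (∑ r ^ s) ^ n`. -/
theorem dimH_le_of_code {X ι : Type*} [EMetricSpace X] [Countable ι] {E : Set X}
    (code : X → ℕ → ι) (r : ι → ℝ≥0∞) {D : ℝ≥0∞} (hD : D ≠ ∞) (s : ℝ≥0)
    (hr : ∀ a, r a ≤ 2⁻¹) (hsum : ∑' a, r a ^ (s : ℝ) ≤ 1)
    (hE : ∀ n : ℕ, ∀ x ∈ E, ∀ y ∈ E, (∀ i < n, code x i = code y i) →
      edist x y ≤ D * ∏ i ∈ Finset.range n, r (code x i)) :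
    dimH E ≤ s := by
  borelize X
  have hdiam : ∀ n : ℕ, ∀ w : Fin n → ι,
      Metric.ediam {x ∈ E | ∀ i : Fin n, code x i = w i} ≤ D * ∏ i, r (w i) := by
    intro n w
    refine Metric.ediam_le fun x hx y hy => ?_
    refine (hE n x hx.1 y hy.1 fun i hi => ?_).trans_eq ?_
    · exact (hx.2 ⟨i, hi⟩).trans (hy.2 ⟨i, hi⟩).symm
    · rw [Finset.prod_range]
      simp only [hx.2]
  refine dimH_le_of_hausdorffMeasure_ne_top (ne_top_of_le_ne_top
    (ENNReal.rpow_ne_top_of_nonneg s.coe_nonneg hD) ?_)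
  refine (Measure.hausdorffMeasure_le_liminf_tsum (ι := fun n : ℕ => Fin n → ι) (s : ℝ) E
    (l := atTop) (fun n : ℕ => D * 2⁻¹ ^ n) ?_
    (fun n w => {x ∈ E | ∀ i : Fin n, code x i = w i}) ?_ ?_).trans ?_
  · simpa using ENNReal.Tendsto.const_mul
      (ENNReal.tendsto_pow_atTop_nhds_zero_of_lt_one (r := 2⁻¹) (by simp)) (Or.inr hD)
  · refine Eventually.of_forall fun n w => (hdiam n w).trans ?_
    gcongr
    exact (Finset.prod_le_pow_card _ _ _ fun i _ => hr (w i)).trans_eq (by simp)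
  · exact Eventually.of_forall fun n x hx =>
      mem_iUnion.2 ⟨fun i : Fin n => code x i, hx, fun _ => rfl⟩
  · refine liminf_le_of_le (by isBoundedDefault) fun b hb => ?_
    obtain ⟨n, hn⟩ := hb.exists
    refine hn.trans ?_
    calc ∑' w : Fin n → ι, Metric.ediam {x ∈ E | ∀ i : Fin n, code x i = w i} ^ (s : ℝ)
        ≤ ∑' w : Fin n → ι, D ^ (s : ℝ) * ∏ i, r (w i) ^ (s : ℝ) := by
          refine ENNReal.tsum_le_tsum fun w => ?_
          rw [ENNReal.prod_rpow_of_nonneg s.coe_nonneg,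
            ← ENNReal.mul_rpow_of_nonneg _ _ s.coe_nonneg]
          exact ENNReal.rpow_le_rpow (hdiam n w) s.coe_nonneg
      _ = D ^ (s : ℝ) * (∑' a, r a ^ (s : ℝ)) ^ n := by
          rw [ENNReal.tsum_mul_left, ENNReal.tsum_prod_fin_eq_pow fun a => r a ^ (s : ℝ)]
      _ ≤ D ^ (s : ℝ) := mul_le_of_le_one_right' (pow_le_one' hsum n)

/-- If sequences over `N` letters that first differ at the index `n` are coded by points at
distance at least `C * κ ^ n`, where `N * κ ^ s ≥ 1`, then reading the sequence of a point as an
expansion in base `N` is an `s`-Hölder map of the coded set onto `[0, 1]`. -/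
theorem le_dimH_range_of_separated {X : Type*} [MetricSpace X] {N : ℕ} (hN : 1 < N)
    {π : (ℕ → Fin N) → X} {C κ : ℝ} {s : ℝ≥0} (hC : 0 < C) (hκ : 0 < κ) (hs : 0 < s)
    (hκs : (N : ℝ)⁻¹ ≤ κ ^ (s : ℝ))
    (hsep : ∀ a b n, (∀ i < n, a i = b i) → a n ≠ b n → C * κ ^ n ≤ dist (π a) (π b)) :
    (s : ℝ≥0∞) ≤ dimH (range π) := by
  have hfirst : ∀ a b : ℕ → Fin N, a ≠ b → ∃ n, (∀ i < n, a i = b i) ∧ a n ≠ b n := by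
    intro a b hab
    have hex := Function.ne_iff.1 hab
    exact ⟨Nat.find hex, fun i hi => not_not.1 (Nat.find_min hex hi), Nat.find_spec hex⟩
  have hinj : Function.Injective π := by
    intro a b hab
    by_contra hne
    obtain ⟨n, h1, h2⟩ := hfirst a b hne
    have := hsep a b n h1 h2
    rw [hab, dist_self] at this
    exact absurd this (not_le.2 (by positivity))
  have : Nonempty (ℕ → Fin N) := ⟨fun _ => ⟨0, by omega⟩⟩
  set f : X → ℝ := fun x => Real.ofDigits (Function.invFun π x) with hf
  have hfπ : ∀ a, f (π a) = Real.ofDigits a := fun a => by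
    simp only [hf, Function.leftInverse_invFun hinj a]
  have hmain : ∀ a b, dist (Real.ofDigits a) (Real.ofDigits b) ≤
      (C ^ (s : ℝ))⁻¹ * dist (π a) (π b) ^ (s : ℝ) := by
    intro a b
    rcases eq_or_ne a b with rfl | hne
    · simp only [dist_self]; positivity
    obtain ⟨n, h1, h2⟩ := hfirst a b hne
    rw [le_inv_mul_iff₀ (by positivity)]
    calc C ^ (s : ℝ) * dist (Real.ofDigits a) (Real.ofDigits b)
        ≤ C ^ (s : ℝ) * (κ ^ (s : ℝ)) ^ n := by
          gcongr
          rw [Real.dist_eq]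
          refine (Real.abs_ofDigits_sub_ofDigits_le h1).trans ?_
          rw [← inv_pow]
          gcongr
      _ = (C * κ ^ n) ^ (s : ℝ) := by
          rw [Real.mul_rpow hC.le (by positivity), ← Real.rpow_mul_natCast hκ.le, mul_comm (s : ℝ),
            Real.rpow_natCast_mul hκ.le]
      _ ≤ _ := by
          gcongr
          exact hsep a b n h1 h2
  have hol : HolderOnWith (Real.toNNReal (C ^ (s : ℝ))⁻¹) s f (range π) := by
    rintro _ ⟨a, rfl⟩ _ ⟨b, rfl⟩
    rw [hfπ, hfπ, edist_dist, edist_dist, ENNReal.ofReal_rpow_of_nonneg dist_nonneg s.coe_nonneg]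
    change _ ≤ ENNReal.ofReal _ * _
    rw [← ENNReal.ofReal_mul (by positivity)]
    exact ENNReal.ofReal_le_ofReal (hmain a b)
  have hsub : Icc (0 : ℝ) 1 ⊆ f '' range π := by
    intro y hy
    obtain ⟨a, -, ha⟩ := Real.ofDigits_SurjOn hN hy
    exact ⟨π a, mem_range_self a, by rw [hfπ, ha]⟩
  have h1 : (1 : ℝ≥0∞) ≤ dimH (range π) / s := by
    calc (1 : ℝ≥0∞) = dimH (Icc (0 : ℝ) 1) := by
          rw [Real.dimH_of_nonempty_interior (by simp)]; simp
      _ ≤ dimH (f '' range π) := dimH_mono hsub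
      _ ≤ _ := hol.dimH_image_le hs
  simpa using (ENNReal.le_div_iff_mul_le (by simp [hs.ne']) (by simp)).1 h1

namespace HurwitzCF

/-! ### The Hurwitz algorithm -/

instance : Countable GaussianInt :=
  Function.Injective.countable (f := fun a : GaussianInt => (a.re, a.im)) fun a b h => by
    simp only [Prod.mk.injEq] at h
    exact Zsqrtd.ext h.1 h.2

lemma one_le_norm_coe {q : GaussianInt} (hq : q ≠ 0) : 1 ≤ ‖(q : ℂ)‖ := by
  have h : (1 : ℝ) ≤ (q.norm : ℝ) := by exact_mod_cast GaussianInt.norm_pos.2 hq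
  rw [GaussianInt.intCast_real_norm, Complex.normSq_eq_norm_sq] at h
  nlinarith [norm_nonneg (q : ℂ)]

lemma sub_nearest_mem_fundSquare (w : ℂ) : w - (nearest w : ℂ) ∈ fundSquare := by
  have h1 := Int.floor_le (w.re + 1 / 2)
  have h2 := Int.lt_floor_add_one (w.re + 1 / 2)
  have h3 := Int.floor_le (w.im + 1 / 2)
  have h4 := Int.lt_floor_add_one (w.im + 1 / 2)
  simp only [fundSquare, nearest, mem_ofPred_eq, Complex.sub_re, Complex.sub_im,
    GaussianInt.re_toComplex, GaussianInt.im_toComplex]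
  exact ⟨by linarith, by linarith, by linarith, by linarith⟩

lemma nearest_add_of_mem_fundSquare (a : GaussianInt) {w : ℂ} (hw : w ∈ fundSquare) :
    nearest (a + w) = a := by
  obtain ⟨h1, h2, h3, h4⟩ := hw
  have e1 := GaussianInt.intCast_re a
  have e2 := GaussianInt.intCast_im a
  refine Zsqrtd.ext (Int.floor_eq_iff.2 ?_) (Int.floor_eq_iff.2 ?_) <;>
    simp only [Complex.add_re, Complex.add_im, ← e1, ← e2] <;>
    exact ⟨by linarith, by linarith⟩

lemma mem_fundSquare_of_norm_lt {w : ℂ} (hw : ‖w‖ < 1 / 2) : w ∈ fundSquare := by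
  have h1 := abs_le.1 (Complex.abs_re_le_norm w)
  have h2 := abs_le.1 (Complex.abs_im_le_norm w)
  exact ⟨by linarith, by linarith, by linarith, by linarith⟩

lemma norm_le_one_of_mem_fundSquare {w : ℂ} (hw : w ∈ fundSquare) : ‖w‖ ≤ 1 := by
  obtain ⟨h1, h2, h3, h4⟩ := hw
  have := Complex.norm_le_abs_re_add_abs_im w
  have h5 : |w.re| ≤ 1 / 2 := abs_le.2 ⟨by linarith, by linarith⟩
  have h6 : |w.im| ≤ 1 / 2 := abs_le.2 ⟨by linarith, by linarith⟩
  linarith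

lemma remainder_hurwitzMap (z : ℂ) (n : ℕ) :
    remainder (hurwitzMap z) n = remainder z (n + 1) :=
  (Function.iterate_succ_apply hurwitzMap n z).symm

lemma element_hurwitzMap (z : ℂ) (n : ℕ) : element (hurwitzMap z) n = element z (n + 1) := by
  rw [element, element, remainder_hurwitzMap]

lemma eq_inv_element_add_hurwitzMap (z : ℂ) : z = ((element z 0 : ℂ) + hurwitzMap z)⁻¹ := by
  simp [element, remainder, hurwitzMap]

lemma hurwitzMap_mem_largeElements {L : ℝ} {z : ℂ} (hz : z ∈ largeElements L) :
    hurwitzMap z ∈ largeElements L :=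
  ⟨sub_nearest_mem_fundSquare _, fun n => by rw [remainder_hurwitzMap]; exact hz.2.1 _,
    fun n => by rw [element_hurwitzMap]; exact hz.2.2 _⟩

lemma dist_inv_add_inv_add {u v w : ℂ} (hv : u + v ≠ 0) (hw : u + w ≠ 0) :
    dist (u + v)⁻¹ (u + w)⁻¹ = dist v w / (‖u + v‖ * ‖u + w‖) := by
  rw [dist_inv_inv₀ hv hw, dist_add_left]

/-! ### Upper bound -/

lemma dist_le_prod_of_element_eq {L : ℝ} (hL : 2 ≤ L) (n : ℕ) :
    ∀ x ∈ largeElements L, ∀ y ∈ largeElements L, (∀ i < n, element x i = element y i) →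
      dist x y ≤ 2 * ∏ i ∈ Finset.range n, 4 / ‖(element x i : ℂ)‖ ^ 2 := by
  induction n with
  | zero =>
    intro x hx y hy _
    have h1 := norm_le_one_of_mem_fundSquare hx.1
    have h2 := norm_le_one_of_mem_fundSquare hy.1
    simpa using (dist_le_norm_add_norm x y).trans (by linarith)
  | succ n ih =>
    intro x hx y hy hxy
    have hx' := hurwitzMap_mem_largeElements hx
    have hy' := hurwitzMap_mem_largeElements hy
    have IH := ih _ hx' _ hy' fun i hi => by
      rw [element_hurwitzMap, element_hurwitzMap]; exact hxy _ (by omega)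
    simp only [element_hurwitzMap] at IH
    have hb : ∀ w ∈ largeElements L,
        ‖(element x 0 : ℂ)‖ / 2 ≤ ‖(element x 0 : ℂ) + hurwitzMap w‖ := by
      intro w hw
      have h1 := norm_le_one_of_mem_fundSquare (hurwitzMap_mem_largeElements hw).1
      have h2 := hx.2.2 0
      have h3 := norm_sub_le_norm_add (element x 0 : ℂ) (hurwitzMap w)
      linarith
    have hx0 := hb x hx
    have hy0 := hb y hy
    have hpos : 0 < ‖(element x 0 : ℂ)‖ / 2 := by linarith [hx.2.2 0]
    have hd : dist x y = dist (hurwitzMap x) (hurwitzMap y) /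
        (‖(element x 0 : ℂ) + hurwitzMap x‖ * ‖(element x 0 : ℂ) + hurwitzMap y‖) := by
      rw [← dist_inv_add_inv_add (norm_pos_iff.1 (hpos.trans_le hx0))
        (norm_pos_iff.1 (hpos.trans_le hy0)), ← eq_inv_element_add_hurwitzMap x,
        hxy 0 (by omega), ← eq_inv_element_add_hurwitzMap y]
    rw [hd, Finset.prod_range_succ']
    calc _ ≤ (2 * ∏ i ∈ Finset.range n, 4 / ‖(element x (i + 1) : ℂ)‖ ^ 2) /
          (‖(element x 0 : ℂ)‖ / 2 * (‖(element x 0 : ℂ)‖ / 2)) := by gcongr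
      _ = _ := by
        have : ‖(element x 0 : ℂ)‖ ≠ 0 := by linarith
        field_simp
        norm_num

lemma summable_four_div_norm_sq_rpow {s : ℝ} (hs : 1 < s) :
    Summable fun a : GaussianInt => (4 / ‖(a : ℂ)‖ ^ 2) ^ s := by
  have h := (EisensteinSeries.summable_one_div_norm_rpow (k := 2 * s) (by linarith)).mul_left
    ((4 : ℝ) ^ s)
  let e : GaussianInt → (Fin 2 → ℤ) := fun a => ![a.re, a.im]
  have he : Function.Injective e := fun a b hab =>
    Zsqrtd.ext (congrFun hab 0) (congrFun hab 1)
  refine Summable.of_nonneg_of_le (fun a => by positivity) (fun a => ?_) (h.comp_injective he)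
  simp only [Function.comp_apply]
  rcases eq_or_ne a 0 with rfl | ha
  · simp only [map_zero, norm_zero]
    rw [zero_pow two_ne_zero, div_zero, Real.zero_rpow (by linarith)]
    positivity
  have hea : e a ≠ 0 := fun h0 => ha (he (h0.trans (by ext i; fin_cases i <;> simp [e])))
  have hle : ‖e a‖ ≤ ‖(a : ℂ)‖ := by
    refine (pi_norm_le_iff_of_nonneg (norm_nonneg _)).2 fun i => ?_
    fin_cases i
    · simpa [e, Int.norm_eq_abs] using Complex.abs_re_le_norm (a : ℂ)
    · simpa [e, Int.norm_eq_abs] using Complex.abs_im_le_norm (a : ℂ)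
  have hpos : 0 < ‖e a‖ := norm_pos_iff.2 hea
  rw [Real.div_rpow (by norm_num) (by positivity), div_eq_mul_inv]
  gcongr
  rw [Real.rpow_neg hpos.le, ← Real.rpow_natCast_mul (norm_nonneg _), Nat.cast_ofNat]
  gcongr

lemma eventually_tsum_indicator_le_one {s : ℝ} (hs : 1 < s) :
    ∀ᶠ L : ℝ in atTop, ∑' a : GaussianInt, {a : GaussianInt | L ≤ ‖(a : ℂ)‖}.indicator
      (fun a => ENNReal.ofReal (4 / ‖(a : ℂ)‖ ^ 2)) a ^ s ≤ 1 := by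
  have hne : ∑' a : GaussianInt, ENNReal.ofReal ((4 / ‖(a : ℂ)‖ ^ 2) ^ s) ≠ ∞ :=
    (summable_four_div_norm_sq_rpow hs).tsum_ofReal_ne_top
  obtain ⟨t, ht⟩ := ((ENNReal.tendsto_tsum_compl_atTop_zero hne).eventually_le_const
    one_pos).exists
  obtain ⟨B, hB⟩ := (t.finite_toSet.image fun a : GaussianInt => ‖(a : ℂ)‖).bddAbove
  filter_upwards [eventually_gt_atTop B] with L hL
  refine le_trans ?_ ht
  rw [show (∑' b : {x // x ∉ t}, ENNReal.ofReal ((4 / ‖((b : GaussianInt) : ℂ)‖ ^ 2) ^ s)) =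
    ∑' a, ({x | x ∉ t} : Set GaussianInt).indicator
      (fun a => ENNReal.ofReal ((4 / ‖(a : ℂ)‖ ^ 2) ^ s)) a from
    tsum_subtype {x | x ∉ t} fun a => ENNReal.ofReal ((4 / ‖(a : ℂ)‖ ^ 2) ^ s)]
  refine ENNReal.tsum_le_tsum fun a => ?_
  by_cases ha : L ≤ ‖(a : ℂ)‖
  · have hat : a ∉ t := fun h => by
      have := hB (mem_image_of_mem _ (Finset.mem_coe.2 h))
      linarith
    rw [indicator_of_mem (by exact ha), indicator_of_mem (by exact hat),
      ENNReal.ofReal_rpow_of_nonneg (by positivity) (by linarith)]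
  · rw [indicator_of_notMem (by exact ha), ENNReal.zero_rpow_of_pos (by linarith)]
    exact zero_le

theorem eventually_dimH_largeElements_le {s : ℝ≥0} (hs : 1 < s) :
    ∀ᶠ L : ℝ in atTop, dimH (largeElements L) ≤ s := by
  filter_upwards [eventually_tsum_indicator_le_one (s := s) (by exact_mod_cast hs),
    eventually_ge_atTop 3] with L hsum hL
  refine dimH_le_of_code element _ (D := 2) (by simp) s (fun a => ?_) hsum ?_
  · by_cases ha : L ≤ ‖(a : ℂ)‖
    · rw [indicator_of_mem (by exact ha), show (2⁻¹ : ℝ≥0∞) = ENNReal.ofReal 2⁻¹ by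
        rw [ENNReal.ofReal_inv_of_pos two_pos, ENNReal.ofReal_ofNat]]
      refine ENNReal.ofReal_le_ofReal ?_
      rw [div_le_iff₀ (by nlinarith)]
      nlinarith
    · rw [indicator_of_notMem (by exact ha)]
      exact zero_le
  · intro n x hx y hy hxy
    have hmem : ∀ i, element x i ∈ {a : GaussianInt | L ≤ ‖(a : ℂ)‖} := hx.2.2
    rw [Finset.prod_congr rfl fun i _ => indicator_of_mem (hmem i) _,
      ← ENNReal.ofReal_prod_of_nonneg fun i _ => by positivity, edist_dist,
      ← ENNReal.ofReal_ofNat, ← ENNReal.ofReal_mul two_pos.le]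
    exact ENNReal.ofReal_le_ofReal (dist_le_prod_of_element_eq (by linarith) n x hx y hy hxy)

/-! ### Values of continued fractions with prescribed large elements -/

/-- The finite continued fraction `[0; a 0, …, a (n - 1)]`. -/
noncomputable def cfApprox : ℕ → (ℕ → GaussianInt) → ℂ
  | 0, _ => 0
  | n + 1, a => ((a 0 : ℂ) + cfApprox n fun i => a (i + 1))⁻¹

/-- The value of the infinite continued fraction `[0; a 0, a 1, …]`. The limit exists as soon as
all elements have absolute value at least `4`. -/
noncomputable def cfValue (a : ℕ → GaussianInt) : ℂ :=
  limUnder atTop fun n => cfApprox n a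

lemma three_le_norm_add {u w : ℂ} (hu : 4 ≤ ‖u‖) (hw : ‖w‖ ≤ 1 / 3) : 3 ≤ ‖u + w‖ := by
  linarith [norm_sub_le_norm_add u w]

lemma norm_cfApprox_le (n : ℕ) {a : ℕ → GaussianInt} (ha : ∀ i, 4 ≤ ‖(a i : ℂ)‖) :
    ‖cfApprox n a‖ ≤ 1 / 3 := by
  induction n generalizing a with
  | zero => simp [cfApprox]
  | succ n ih =>
    rw [cfApprox, norm_inv, one_div]
    gcongr
    exact three_le_norm_add (ha 0) (ih fun i => ha (i + 1))

lemma dist_cfApprox_succ_le (n : ℕ) {a : ℕ → GaussianInt} (ha : ∀ i, 4 ≤ ‖(a i : ℂ)‖) :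
    dist (cfApprox n a) (cfApprox (n + 1) a) ≤ 1 * (1 / 9) ^ n := by
  induction n generalizing a with
  | zero =>
    rw [cfApprox, dist_zero_left]
    linarith [norm_cfApprox_le 1 ha]
  | succ n ih =>
    have h1 := three_le_norm_add (ha 0) (norm_cfApprox_le n fun i => ha (i + 1))
    have h2 := three_le_norm_add (ha 0) (norm_cfApprox_le (n + 1) fun i => ha (i + 1))
    rw [cfApprox, cfApprox, dist_inv_add_inv_add (norm_pos_iff.1 (by linarith))
      (norm_pos_iff.1 (by linarith))]
    calc _ ≤ 1 * (1 / 9 : ℝ) ^ n / (3 * 3) := by gcongr; exact ih fun i => ha (i + 1)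
      _ = _ := by rw [pow_succ]; ring

lemma tendsto_cfApprox {a : ℕ → GaussianInt} (ha : ∀ i, 4 ≤ ‖(a i : ℂ)‖) :
    Tendsto (fun n => cfApprox n a) atTop (𝓝 (cfValue a)) :=
  (cauchySeq_of_le_geometric (1 / 9) 1 (by norm_num) fun n =>
    dist_cfApprox_succ_le n ha).tendsto_limUnder

lemma norm_cfValue_le {a : ℕ → GaussianInt} (ha : ∀ i, 4 ≤ ‖(a i : ℂ)‖) :
    ‖cfValue a‖ ≤ 1 / 3 :=
  le_of_tendsto (tendsto_cfApprox ha).norm (Eventually.of_forall fun n => norm_cfApprox_le n ha)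

lemma cfValue_eq {a : ℕ → GaussianInt} (ha : ∀ i, 4 ≤ ‖(a i : ℂ)‖) :
    cfValue a = ((a 0 : ℂ) + cfValue fun i => a (i + 1))⁻¹ := by
  have ha' : ∀ i, 4 ≤ ‖(a (i + 1) : ℂ)‖ := fun i => ha (i + 1)
  refine tendsto_nhds_unique ((tendsto_cfApprox ha).comp (tendsto_add_atTop_nat 1)) ?_
  exact ((tendsto_cfApprox ha').const_add (a 0 : ℂ)).inv₀
    (norm_pos_iff.1 (by linarith [three_le_norm_add (ha 0) (norm_cfValue_le ha')]))

lemma inv_le_norm_cfValue {a : ℕ → GaussianInt} (ha : ∀ i, 4 ≤ ‖(a i : ℂ)‖) {B : ℝ}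
    (hB : ‖(a 0 : ℂ)‖ + 1 ≤ B) : B⁻¹ ≤ ‖cfValue a‖ := by
  have h1 := norm_cfValue_le fun i => ha (i + 1)
  have h2 := three_le_norm_add (ha 0) h1
  rw [cfValue_eq ha, norm_inv]
  gcongr
  linarith [norm_add_le (a 0 : ℂ) (cfValue fun i => a (i + 1))]

lemma cfValue_ne_zero {a : ℕ → GaussianInt} (ha : ∀ i, 4 ≤ ‖(a i : ℂ)‖) : cfValue a ≠ 0 :=
  norm_pos_iff.1 (lt_of_lt_of_le (by positivity) (inv_le_norm_cfValue ha le_rfl))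

lemma cfValue_mem_fundSquare {a : ℕ → GaussianInt} (ha : ∀ i, 4 ≤ ‖(a i : ℂ)‖) :
    cfValue a ∈ fundSquare :=
  mem_fundSquare_of_norm_lt (by linarith [norm_cfValue_le ha])

lemma nearest_inv_cfValue {a : ℕ → GaussianInt} (ha : ∀ i, 4 ≤ ‖(a i : ℂ)‖) :
    nearest (cfValue a)⁻¹ = a 0 := by
  rw [cfValue_eq ha, inv_inv,
    nearest_add_of_mem_fundSquare _ (cfValue_mem_fundSquare fun i => ha (i + 1))]

lemma hurwitzMap_cfValue {a : ℕ → GaussianInt} (ha : ∀ i, 4 ≤ ‖(a i : ℂ)‖) :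
    hurwitzMap (cfValue a) = cfValue fun i => a (i + 1) := by
  rw [hurwitzMap, nearest_inv_cfValue ha, cfValue_eq ha, inv_inv, add_sub_cancel_left]

lemma remainder_cfValue {a : ℕ → GaussianInt} (ha : ∀ i, 4 ≤ ‖(a i : ℂ)‖) (n : ℕ) :
    remainder (cfValue a) n = cfValue fun i => a (i + n) := by
  induction n generalizing a with
  | zero => rfl
  | succ n ih =>
    rw [← remainder_hurwitzMap, hurwitzMap_cfValue ha, ih fun i => ha (i + 1)]
    simp only [add_assoc]

lemma element_cfValue {a : ℕ → GaussianInt} (ha : ∀ i, 4 ≤ ‖(a i : ℂ)‖) (n : ℕ) :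
    element (cfValue a) n = a n := by
  rw [element, remainder_cfValue ha, nearest_inv_cfValue fun i => ha (i + n), zero_add]

/-- Since all tails `[0; a n, a (n + 1), …]` have absolute value less than `1 / 2`, the Hurwitz
algorithm recovers the elements `a n`: no condition on consecutive elements is needed. -/
lemma cfValue_mem_largeElements {a : ℕ → GaussianInt} (ha : ∀ i, 4 ≤ ‖(a i : ℂ)‖) {L : ℝ}
    (hL : ∀ i, L ≤ ‖(a i : ℂ)‖) : cfValue a ∈ largeElements L :=
  ⟨cfValue_mem_fundSquare ha,
    fun n => by rw [remainder_cfValue ha]; exact cfValue_ne_zero fun i => ha (i + n),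
    fun n => by rw [element_cfValue ha]; exact hL n⟩

lemma le_dist_cfValue {B : ℝ} (n : ℕ) {a b : ℕ → GaussianInt} (ha : ∀ i, 4 ≤ ‖(a i : ℂ)‖)
    (hb : ∀ i, 4 ≤ ‖(b i : ℂ)‖) (haB : ∀ i, ‖(a i : ℂ)‖ + 1 ≤ B) (hbB : ∀ i, ‖(b i : ℂ)‖ + 1 ≤ B)
    (hab : ∀ i < n, a i = b i) (hn : a n ≠ b n) :
    (B ^ 2)⁻¹ / 3 * (B ^ 2)⁻¹ ^ n ≤ dist (cfValue a) (cfValue b) := by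
  have hbound : ∀ c : ℕ → GaussianInt, (∀ i, 4 ≤ ‖(c i : ℂ)‖) → (∀ i, ‖(c i : ℂ)‖ + 1 ≤ B) →
      0 < ‖(c 0 : ℂ) + cfValue fun i => c (i + 1)‖ ∧
      ‖(c 0 : ℂ) + cfValue fun i => c (i + 1)‖ ≤ B := by
    intro c hc hcB
    have h1 := norm_cfValue_le fun i => hc (i + 1)
    have h2 := three_le_norm_add (hc 0) h1
    exact ⟨by linarith, by linarith [norm_add_le (c 0 : ℂ) (cfValue fun i => c (i + 1)), hcB 0]⟩
  obtain ⟨ha0, ha1⟩ := hbound a ha haB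
  obtain ⟨hb0, hb1⟩ := hbound b hb hbB
  have hB : 0 ≤ B := ha0.le.trans ha1
  induction n generalizing a b with
  | zero =>
    have h3 := one_le_norm_coe (sub_ne_zero.2 hn)
    rw [GaussianInt.toComplex_sub] at h3
    have h4 := norm_cfValue_le fun i => ha (i + 1)
    have h5 := norm_cfValue_le fun i => hb (i + 1)
    have h6 : 1 / 3 ≤ dist ((a 0 : ℂ) + cfValue fun i => a (i + 1))
        ((b 0 : ℂ) + cfValue fun i => b (i + 1)) := by
      rw [dist_eq_norm, add_sub_add_comm]
      have := norm_sub_le_norm_add ((a 0 : ℂ) - b 0)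
        ((cfValue fun i => a (i + 1)) - cfValue fun i => b (i + 1))
      have := norm_sub_le (cfValue fun i => a (i + 1)) (cfValue fun i => b (i + 1))
      linarith
    rw [cfValue_eq ha, cfValue_eq hb, dist_inv_inv₀ (norm_pos_iff.1 ha0) (norm_pos_iff.1 hb0),
      pow_zero, mul_one]
    calc (B ^ 2)⁻¹ / 3 = 1 / 3 / (B * B) := by ring
      _ ≤ _ := by gcongr
  | succ n ih =>
    have ha' : ∀ i, 4 ≤ ‖(a (i + 1) : ℂ)‖ := fun i => ha (i + 1)
    have hb' : ∀ i, 4 ≤ ‖(b (i + 1) : ℂ)‖ := fun i => hb (i + 1)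
    have haB' : ∀ i, ‖(a (i + 1) : ℂ)‖ + 1 ≤ B := fun i => haB (i + 1)
    have hbB' : ∀ i, ‖(b (i + 1) : ℂ)‖ + 1 ≤ B := fun i => hbB (i + 1)
    have IH := ih ha' hb' haB' hbB' (fun i hi => hab (i + 1) (by omega)) hn
      (hbound _ ha' haB').1 (hbound _ ha' haB').2 (hbound _ hb' hbB').1 (hbound _ hb' hbB').2
    rw [cfValue_eq ha, cfValue_eq hb, dist_inv_inv₀ (norm_pos_iff.1 ha0) (norm_pos_iff.1 hb0),
      hab 0 (by omega), dist_add_left]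
    rw [hab 0 (by omega)] at ha0 ha1
    calc (B ^ 2)⁻¹ / 3 * (B ^ 2)⁻¹ ^ (n + 1)
        = (B ^ 2)⁻¹ / 3 * (B ^ 2)⁻¹ ^ n / (B * B) := by ring
      _ ≤ _ := by gcongr

/-! ### Bounded elements and bad approximability -/

/-- Descent on the norm of `q`. With `z = (a + w)⁻¹` and `l = q z - p`, the linear form of `w` at
the pair `(q - p a, p)` is `-l / z`. The quantity `‖q‖ ‖l‖ - ‖l‖ ^ 2 / 2` does not increase in this
step, since `‖z‖ ≤ 1 / 3`; the correction term `‖l‖ ^ 2 / 2` absorbs the error in `‖q z‖ ≈ ‖p‖`. -/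
lemma half_le_norm_mul_norm_sub {B : ℝ} (k : ℕ) :
    ∀ a : ℕ → GaussianInt, (∀ i, 4 ≤ ‖(a i : ℂ)‖) → (∀ i, ‖(a i : ℂ)‖ + 1 ≤ B) →
    ∀ p q : GaussianInt, q ≠ 0 → q.norm.natAbs ≤ k → ‖(q : ℂ) * cfValue a - p‖ ≤ 1 →
      B⁻¹ / 2 ≤ ‖(q : ℂ)‖ * ‖(q : ℂ) * cfValue a - p‖ - ‖(q : ℂ) * cfValue a - p‖ ^ 2 / 2 := by
  induction k with
  | zero =>
    intro a _ _ p q hq hk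
    have := GaussianInt.norm_pos.2 hq
    omega
  | succ k ih =>
    intro a ha haB p q hq hk hl
    set z := cfValue a with hz
    set w := cfValue fun i => a (i + 1) with hw
    set l := (q : ℂ) * z - p with hldef
    have hz0 : z ≠ 0 := cfValue_ne_zero ha
    have hz1 : ‖z‖ ≤ 1 / 3 := norm_cfValue_le ha
    have hzB : B⁻¹ ≤ ‖z‖ := inv_le_norm_cfValue ha (haB 0)
    have hq1 : 1 ≤ ‖(q : ℂ)‖ := one_le_norm_coe hq
    have hzpos : 0 < ‖z‖ := norm_pos_iff.2 hz0
    -- Once `‖l‖ ≥ ‖z‖`, which includes the case `p = 0`, the bound holds without descending.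
    rcases le_or_gt ‖z‖ ‖l‖ with hlz | hlz
    · nlinarith [mul_nonneg (sub_nonneg.2 hq1) (norm_nonneg l)]
    have hqz : ‖(q : ℂ) * z‖ = ‖(q : ℂ)‖ * ‖z‖ := norm_mul _ _
    have hp : p ≠ 0 := by
      rintro rfl
      rw [hldef, map_zero, sub_zero, hqz] at hlz
      nlinarith
    have hpq : ‖(p : ℂ)‖ ≤ ‖(q : ℂ)‖ * ‖z‖ + ‖l‖ := by
      have h := norm_sub_le ((q : ℂ) * z) l
      rwa [hldef, sub_sub_cancel, hqz] at h
    have hzw : z * ((a 0 : ℂ) + w) = 1 := by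
      have h := cfValue_eq ha
      rw [← hz, ← hw] at h
      rw [← inv_inv ((a 0 : ℂ) + w), ← h, mul_inv_cancel₀ hz0]
    have hstep : l = -z * ((p : ℂ) * w - ((q - p * a 0 : GaussianInt) : ℂ)) := by
      rw [GaussianInt.toComplex_sub, GaussianInt.toComplex_mul]
      linear_combination (p : ℂ) * hzw + hldef
    set m := (p : ℂ) * w - ((q - p * a 0 : GaussianInt) : ℂ) with hm
    have hlm : ‖l‖ = ‖z‖ * ‖m‖ := by rw [hstep, norm_mul, norm_neg]
    have hm1 : ‖m‖ ≤ 1 := by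
      rw [hlm] at hlz
      nlinarith
    have hlt : p.norm.natAbs < q.norm.natAbs := by
      have h : ‖(p : ℂ)‖ < ‖(q : ℂ)‖ := by nlinarith
      have h2 : (p.norm : ℝ) < q.norm := by
        rw [GaussianInt.intCast_real_norm, GaussianInt.intCast_real_norm,
          Complex.normSq_eq_norm_sq, Complex.normSq_eq_norm_sq]
        gcongr
      have h3 : p.norm < q.norm := by exact_mod_cast h2
      have := GaussianInt.norm_nonneg p
      omega
    have IH := ih (fun i => a (i + 1)) (fun i => ha (i + 1)) (fun i => haB (i + 1))
      (q - p * a 0) p hp (by omega) hm1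
    rw [← hw, ← hm] at IH
    have h1 : ‖(p : ℂ)‖ * ‖m‖ ≤ ‖(q : ℂ)‖ * ‖l‖ + ‖z‖ * ‖m‖ ^ 2 := by
      have := mul_le_mul_of_nonneg_right hpq (norm_nonneg m)
      rw [hlm] at this ⊢
      linarith
    have h2 : ‖z‖ * ‖m‖ ^ 2 + ‖l‖ ^ 2 / 2 ≤ ‖m‖ ^ 2 / 2 := by
      rw [hlm]
      have : ‖z‖ + ‖z‖ ^ 2 / 2 ≤ 1 / 2 := by nlinarith
      nlinarith [mul_le_mul_of_nonneg_right this (sq_nonneg ‖m‖)]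
    linarith

lemma exists_eq_div_of_mem_gaussianRationals {z : ℂ} (hz : z ∈ gaussianRationals) :
    ∃ p q : GaussianInt, q ≠ 0 ∧ z = (p : ℂ) / (q : ℂ) := by
  obtain ⟨r, s, rfl⟩ := hz
  refine ⟨⟨r.num * s.den, s.num * r.den⟩, ⟨r.den * s.den, 0⟩, fun h => ?_, ?_⟩
  · have := congrArg Zsqrtd.re h
    simp at this
  · have hr : (r.den : ℂ) ≠ 0 := by exact_mod_cast r.den_nz
    have hs : (s.den : ℂ) ≠ 0 := by exact_mod_cast s.den_nz
    rw [GaussianInt.toComplex_def', GaussianInt.toComplex_def']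
    rw [Rat.cast_def r, Rat.cast_def s]
    push_cast
    field_simp
    ring

lemma cfValue_mem_badlyApproximable {B : ℝ} {a : ℕ → GaussianInt} (ha : ∀ i, 4 ≤ ‖(a i : ℂ)‖)
    (haB : ∀ i, ‖(a i : ℂ)‖ + 1 ≤ B) : cfValue a ∈ badlyApproximable := by
  have hB : 1 ≤ B := by linarith [ha 0, haB 0]
  have hmain : ∀ p q : GaussianInt, q ≠ 0 →
      B⁻¹ / 2 / ‖(q : ℂ)‖ ^ 2 ≤ ‖cfValue a - (p : ℂ) / (q : ℂ)‖ := by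
    intro p q hq
    have hq1 := one_le_norm_coe hq
    have hq0 : (q : ℂ) ≠ 0 := norm_pos_iff.1 (by linarith)
    have hl : ‖(q : ℂ) * cfValue a - p‖ = ‖(q : ℂ)‖ * ‖cfValue a - (p : ℂ) / (q : ℂ)‖ := by
      rw [← norm_mul, mul_sub, mul_div_cancel₀ _ hq0]
    have key : B⁻¹ / 2 ≤ ‖(q : ℂ)‖ * ‖(q : ℂ) * cfValue a - p‖ := by
      rcases le_or_gt ‖(q : ℂ) * cfValue a - p‖ 1 with h | h
      · have := half_le_norm_mul_norm_sub _ a ha haB p q hq le_rfl h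
        nlinarith [sq_nonneg ‖(q : ℂ) * cfValue a - p‖]
      · have := inv_le_one_of_one_le₀ hB
        nlinarith
    rw [div_le_iff₀ (by positivity)]
    rw [hl] at key
    linarith
  refine ⟨fun h => ?_, B⁻¹ / 2, by positivity, hmain⟩
  obtain ⟨p, q, hq, hpq⟩ := exists_eq_div_of_mem_gaussianRationals h
  have h1 := hmain p q hq
  have hq1 := one_le_norm_coe hq
  rw [← hpq, sub_self, norm_zero] at h1
  exact absurd h1 (not_le.2 (by positivity))

/-! ### Lower bound -/

/-- The `M ^ 2` Gaussian integers `m + n i` with `M ≤ m, n < 2 M`. -/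
def letter (M : ℕ) (d : Fin (M * M)) : GaussianInt :=
  ⟨(M + d / M : ℕ), (M + d % M : ℕ)⟩

lemma letter_injective (M : ℕ) : Function.Injective (letter M) := by
  intro d e h
  have h1 : ((M + d / M : ℕ) : ℤ) = (M + e / M : ℕ) := congrArg Zsqrtd.re h
  have h2 : ((M + d % M : ℕ) : ℤ) = (M + e % M : ℕ) := congrArg Zsqrtd.im h
  have h3 : (d : ℕ) / M = e / M := by omega
  have h4 : (d : ℕ) % M = e % M := by omega
  exact Fin.ext (by rw [← Nat.div_add_mod (d : ℕ) M, h3, h4, Nat.div_add_mod])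

lemma le_norm_letter (M : ℕ) (d : Fin (M * M)) : (M : ℝ) ≤ ‖(letter M d : ℂ)‖ := by
  refine le_trans ?_ ((le_abs_self _).trans (Complex.abs_re_le_norm _))
  rw [letter, GaussianInt.re_toComplex]
  push_cast
  exact le_add_of_nonneg_right (by positivity)

lemma norm_letter_le (M : ℕ) (d : Fin (M * M)) : ‖(letter M d : ℂ)‖ ≤ 4 * M := by
  have hM : 0 < M := Nat.pos_of_mul_pos_right d.pos
  refine (Complex.norm_le_abs_re_add_abs_im _).trans ?_
  rw [letter, GaussianInt.re_toComplex, GaussianInt.im_toComplex, Int.cast_natCast,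
    Int.cast_natCast, Nat.abs_cast, Nat.abs_cast]
  have h1 : (d : ℕ) / M ≤ M := (Nat.div_lt_of_lt_mul d.2).le
  have h2 : (d : ℕ) % M ≤ M := (Nat.mod_lt _ hM).le
  have h3 : M + d / M + (M + d % M) ≤ 4 * M := by omega
  exact_mod_cast h3

lemma eventually_inv_sq_le_rpow {s : ℝ} (hs : s < 1) :
    ∀ᶠ M : ℕ in atTop, ((M * M : ℕ) : ℝ)⁻¹ ≤ (((5 * M : ℝ) ^ 2)⁻¹) ^ s := by
  have ht : Tendsto (fun M : ℕ => ((M : ℝ) ^ 2) ^ (1 - s)) atTop atTop :=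
    (tendsto_rpow_atTop (by linarith)).comp
      ((tendsto_pow_atTop two_ne_zero).comp tendsto_natCast_atTop_atTop)
  filter_upwards [ht.eventually_ge_atTop ((25 : ℝ) ^ s), eventually_gt_atTop 0] with M hM hM0
  have hpos : (0 : ℝ) < (M : ℝ) ^ 2 := by positivity
  rw [Real.inv_rpow (by positivity), Nat.cast_mul, ← sq]
  gcongr
  calc ((5 * M : ℝ) ^ 2) ^ s = 25 ^ s * ((M : ℝ) ^ 2) ^ s := by
        rw [← Real.mul_rpow (by norm_num) hpos.le]; congr 1; ring
    _ ≤ ((M : ℝ) ^ 2) ^ (1 - s) * ((M : ℝ) ^ 2) ^ s := by gcongr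
    _ = (M : ℝ) ^ 2 := by rw [← Real.rpow_add hpos]; simp

theorem le_dimH_largeElements_inter_badlyApproximable (L : ℝ) {s : ℝ≥0} (hs0 : 0 < s)
    (hs : s < 1) : (s : ℝ≥0∞) ≤ dimH (largeElements L ∩ badlyApproximable) := by
  obtain ⟨M, hMs, hML, hM4⟩ := ((eventually_inv_sq_le_rpow (s := s)
    (by exact_mod_cast hs)).and ((tendsto_natCast_atTop_atTop.eventually_ge_atTop L).and
    (eventually_ge_atTop 4))).exists
  have hM4' : (4 : ℝ) ≤ M := by exact_mod_cast hM4
  have h4 : ∀ (d : ℕ → Fin (M * M)) (i : ℕ), 4 ≤ ‖(letter M (d i) : ℂ)‖ := fun d i =>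
    hM4'.trans (le_norm_letter M _)
  have hB : ∀ (d : ℕ → Fin (M * M)) (i : ℕ), ‖(letter M (d i) : ℂ)‖ + 1 ≤ 5 * M := fun d i => by
    linarith [norm_letter_le M (d i)]
  refine (le_dimH_range_of_separated (π := fun d => cfValue fun i => letter M (d i))
    (C := ((5 * M : ℝ) ^ 2)⁻¹ / 3) (by nlinarith) (by positivity) (by positivity) hs0 hMs
    fun d e n hde hn => ?_).trans (dimH_mono ?_)
  · exact le_dist_cfValue n (h4 d) (h4 e) (hB d) (hB e) (fun i hi => by rw [hde i hi])
      fun h => hn (letter_injective M h)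
  · rintro _ ⟨d, rfl⟩
    exact ⟨cfValue_mem_largeElements (h4 d) fun i => hML.trans (le_norm_letter M _),
      cfValue_mem_badlyApproximable (h4 d) (hB d)⟩

end HurwitzCF

theorem corollary1p4 :
    Filter.Tendsto
      (fun L : ℝ => dimH (HurwitzCF.largeElements L ∩ HurwitzCF.badlyApproximable))
      Filter.atTop (nhds 1) := by
  refine tendsto_order.2 ⟨fun u hu => Eventually.of_forall fun L => ?_, fun u hu => ?_⟩
  · obtain ⟨s, hus, hs1⟩ := ENNReal.lt_iff_exists_nnreal_btwn.1 hu
    exact hus.trans_le (HurwitzCF.le_dimH_largeElements_inter_badlyApproximable L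
      (by exact_mod_cast (zero_le).trans_lt hus) (by exact_mod_cast hs1))
  · obtain ⟨s, hs1, hsu⟩ := ENNReal.lt_iff_exists_nnreal_btwn.1 hu
    filter_upwards [HurwitzCF.eventually_dimH_largeElements_le (s := s) (by exact_mod_cast hs1)]
      with L hL
    exact ((dimH_mono inter_subset_left).trans hL).trans_lt hsu
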